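/- **Theorem 4.1.** Manifolds are Hausdorff, second countable, without boundary, and of constant finite dimension. Let $N$ and $P$ be $C^1$-manifolds and let $V\subset N$ be closed. Let $\Sigma$ be a *prestratification* of $V$, i.e. a collection of pairwise disjoint connected embedded $C^1$-submanifolds of $N$ (the *strata*) with union $V$ such that every point of $V$ has a neighbourhood in $N$ meeting only finitely many strata. Let $f:N\to P$ be a *stratified map* for $\Sigma$, i.e. a $C^1$-map such that for each stratum $S$ the restriction $f|_S$ has constant rank. For a stratum $S$ let $\mathfrak F^f_S$ be the foliation of $S$ whose leaves are the connected components of the fibres of $f|_S$, and for $x\in S$ let $T_x(\mathfrak F^f_S)\subset T_xN$ be the tangent space at $x$ of the leaf through $x$. For strata $X,Y$ and $y\in Y\cap\overline X$, $X$ is *$(a_f)$-regular over $Y$ at $y$* if, for every sequence $(x_i)$ in $X$ with $x_i\to y$ such that $T_{x_i}(\mathfrak F^f_X)$ converges in the Grassmann bundle of $N$ to a subspace $\tau\subset T_yN$, one has $T_y(\mathfrak F^f_Y)\subset\tau$. The prestratification $\Sigma$ is *$(a_f)$-regular* (Thom regular) if $X$ is $(a_f)$-regular over $Y$ at every point of $Y\cap\overline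 X$, for all strata $X,Y\in\Sigma$. For a $C^1$-manifold $M$ let $C^1(M,N)$ be the set of $C^1$-maps $M\to N$. Its *strong (Whitney) topology* is generated by the following sets: given a locally finite family of charts $(\varphi_i,U_i)$ of $M$, compact sets $K_i\subset U_i$, charts $(\psi_i,V_i)$ of $N$, numbers $\varepsilon_i>0$ and $h\in C^1(M,N)$ with $h(K_i)\subset V_i$ for all $i$, take the set of all $g\in C^1(M,N)$ such that for all $i$ one has $g(K_i)\subset V_i$, and on $\varphi_i(K_i)$ both $\psi_i h\varphi_i^{-1}-\psi_i g\varphi_i^{-1}$ and its derivative have norm $<\varepsilon_i$. For $g\in C^1(M,N)$ write $g\pitchfork\mathfrak F^f_\Sigma$ if $g$ is transverse to every leaf $L$ of $\mathfrak F^f_S$ for every stratum $S$, i.e. $Dg_w(T_wM)+T_{g(w)}L=T_{g(w)}N$ whenever $w\in M$ and $g(w)\in L$. Then the following are equivalent: 1. $\Sigma$ is $(a_f)$-regular; 2. for every $C^1$-manifold $M$, the set $\{g\in C^1(M,N): g\pitchfork\mathfrak F^f_\Sigma\}$ is open in the strong topology; 3. the set $\{g\in C^1(N,N): g\pitchfork\mathfrak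 F^f_\Sigma\}$ is open in the strong topology. -/

import Mathlib

open Set Filter Topology
open scoped Manifold ContDiff

universe u v w

namespace ThomRegularity

noncomputable section

/-- The model space `ℝⁿ` with its Euclidean norm. -/
abbrev Euc (n : ℕ) : Type := EuclideanSpace ℝ (Fin n)

/-- The leaf through `x` of the foliation that `f` induces on `S`: the connected component of `x`
in the fibre of `f|_S` through `x`. -/
def leaf {N : Type u} [TopologicalSpace N] {P : Type v} (f : N → P) (S : Set N) (x : N) : Set N :=
  connectedComponentIn (S ∩ f ⁻¹' {f x}) x

section Submanifolds

variable (n : ℕ) {N : Type u} [TopologicalSpace N] [ChartedSpace (Euc n) N]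

/-- `S` is an embedded `C¹` submanifold of `N`: near each of its points it is a linear slice of
fixed dimension `k` in some chart of the `C¹` structure of `N`. -/
def IsEmbeddedSubmanifold (S : Set N) : Prop :=
  ∃ k : ℕ, ∀ x ∈ S, ∃ φ ∈ IsManifold.maximalAtlas (𝓡 n) 1 N, x ∈ φ.source ∧
    ∃ E : Submodule ℝ (Euc n), Module.finrank ℝ E = k ∧ ∀ p ∈ φ.source, (p ∈ S ↔ φ p ∈ E)

/-- The tangent space at `x` of a subset `S` of `N`: the subspace of `T_x N` spanned by the
velocities at `x` of the `C¹` curves that lie in `S`. If `S` is a submanifold, these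
velocities already form its usual tangent space; the span turns them into a `Submodule`.
The equation in the tangent bundle says that `γ 0 = x` and `γ' 0 = v`. -/
def tangentTo (S : Set N) (x : N) : Submodule ℝ (TangentSpace (𝓡 n) x) :=
  Submodule.span ℝ {v | ∃ γ : ℝ → N, ContMDiffAt 𝓘(ℝ, ℝ) (𝓡 n) 1 γ 0 ∧
    (∀ᶠ t in 𝓝 (0 : ℝ), γ t ∈ S) ∧
    tangentMap 𝓘(ℝ, ℝ) (𝓡 n) γ ⟨0, (1 : ℝ)⟩ = (⟨x, v⟩ : TangentBundle (𝓡 n) N)}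

/-- A prestratification `Strata` of `V`: pairwise disjoint connected embedded submanifolds of `N`
with union `V`, locally finite at the points of `V`. -/
structure IsPrestratification (V : Set N) (Strata : Set (Set N)) : Prop where
  pairwiseDisjoint : Strata.PairwiseDisjoint id
  sUnion_eq : ⋃₀ Strata = V
  isEmbeddedSubmanifold : ∀ S ∈ Strata, IsEmbeddedSubmanifold n S
  isConnected : ∀ S ∈ Strata, IsConnected S
  locallyFinite : ∀ x ∈ V, ∃ U ∈ 𝓝 x, {S ∈ Strata | (S ∩ U).Nonempty}.Finite

/-- Convergence in the Grassmann bundle of `N`: the subspaces `L i` of `T_{x i} N` converge to the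
subspace `τ` of `T_y N`. The points converge, and the images of the subspaces in `ℝⁿ` under the
derivative of a chart at `y` converge in the Grassmannian, whose topology is given by the operator
norm distance of the orthogonal projections (this forces the dimensions to agree eventually). -/
def GrassmannTendsto (x : ℕ → N) (L : ∀ i, Submodule ℝ (TangentSpace (𝓡 n) (x i)))
    (y : N) (τ : Submodule ℝ (TangentSpace (𝓡 n) y)) : Prop :=
  Tendsto x atTop (𝓝 y) ∧
    Tendsto
      (fun i => (Submodule.map
        (mfderiv (𝓡 n) 𝓘(ℝ, Euc n) (chartAt (Euc n) y) (x i)).toLinearMap (L i) :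
          Submodule ℝ (Euc n)).starProjection)
      atTop
      (𝓝 (Submodule.map
        (mfderiv (𝓡 n) 𝓘(ℝ, Euc n) (chartAt (Euc n) y) y).toLinearMap τ :
          Submodule ℝ (Euc n)).starProjection)

section StratifiedMaps

variable (p : ℕ) {P : Type v} [TopologicalSpace P] [ChartedSpace (Euc p) P]

/-- `f` has constant rank on `S`: the rank of `d_x(f|_S)`, the restriction of `d_x f` to the tangent
space of `S`, does not depend on `x ∈ S`. -/
def HasConstantRankOn (f : N → P) (S : Set N) : Prop :=
  ∃ r : ℕ, ∀ x ∈ S, Module.finrank ℝ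
    (Submodule.map (mfderiv (𝓡 n) (𝓡 p) f x).toLinearMap (tangentTo n S x)) = r

/-- `f` is a stratified map for the prestratification `Strata`. -/
structure IsStratifiedMap (f : N → P) (Strata : Set (Set N)) : Prop where
  contMDiff : ContMDiff (𝓡 n) (𝓡 p) 1 f
  hasConstantRankOn : ∀ S ∈ Strata, HasConstantRankOn n p f S

end StratifiedMaps

variable {P : Type v}

/-- The tangent space at `x` of the leaf through `x` of the foliation that `f` induces on `S`. -/
def leafTangent (f : N → P) (S : Set N) (x : N) : Submodule ℝ (TangentSpace (𝓡 n) x) :=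
  tangentTo n (leaf f S x) x

/-- `X` is `(a_f)`-regular over `Y` at `y`. -/
def IsThomRegularAt (f : N → P) (X Y : Set N) (y : N) : Prop :=
  ∀ x : ℕ → N, (∀ i, x i ∈ X) → Tendsto x atTop (𝓝 y) →
    ∀ τ : Submodule ℝ (TangentSpace (𝓡 n) y),
      GrassmannTendsto n x (fun i => leafTangent n f X (x i)) y τ → leafTangent n f Y y ≤ τ

/-- Every ordered pair of strata is `(a_f)`-regular. -/
def IsThomRegular (f : N → P) (Strata : Set (Set N)) : Prop :=
  ∀ X ∈ Strata, ∀ Y ∈ Strata, ∀ y ∈ Y ∩ closure X, IsThomRegularAt n f X Y y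

end Submanifolds

section Maps

variable (m : ℕ) {M : Type w} [TopologicalSpace M] [ChartedSpace (Euc m) M]
variable (n : ℕ) {N : Type u} [TopologicalSpace N] [ChartedSpace (Euc n) N]
variable {P : Type v}

/-- `g` is transverse to the submanifold `A` of `N` at the point `q`. -/
def TransverseAt (g : M → N) (A : Set N) (q : M) : Prop :=
  g q ∈ A → LinearMap.range (mfderiv (𝓡 m) (𝓡 n) g q).toLinearMap ⊔ tangentTo n A (g q) = ⊤

/-- `g` is transverse to every leaf of the foliation that `f` induces on every stratum. -/
def TransverseToFoliation (f : N → P) (Strata : Set (Set N)) (g : M → N) : Prop :=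
  ∀ S ∈ Strata, ∀ x ∈ S, ∀ q : M, TransverseAt m n g (leaf f S x) q

variable {m n}

/-- The set of `C¹` maps `g : M → N` with `g (K i)` contained in the domain of `ψ i` for all `i`, and
such that in the charts `φ i`, `ψ i` both `g - f` and its derivative have norm less than `ε i` at all
points of `K i`. -/
def strongBasicSet {ι : Type w} (φ : ι → OpenPartialHomeomorph M (Euc m))
    (ψ : ι → OpenPartialHomeomorph N (Euc n)) (K : ι → Set M) (ε : ι → ℝ)
    (f : C^1⟮𝓡 m, M; 𝓡 n, N⟯) : Set C^1⟮𝓡 m, M; 𝓡 n, N⟯ :=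
  {g | ∀ i, MapsTo g (K i) (ψ i).source ∧ ∀ q ∈ K i,
    ‖ψ i (f q) - ψ i (g q)‖ < ε i ∧
    ‖fderiv ℝ (ψ i ∘ f ∘ (φ i).symm) (φ i q) - fderiv ℝ (ψ i ∘ g ∘ (φ i).symm) (φ i q)‖ < ε i}

/-- The strong (Whitney) topology on `C¹(M, N)`, generated by the sets `strongBasicSet φ ψ K ε f` for
locally finite families of charts `φ i` of `M`, compact sets `K i` in the domains of the `φ i`,
charts `ψ i` of `N` whose domains contain `f (K i)`, and positive numbers `ε i`. -/
@[reducible]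
def strongTopology (m : ℕ) (M : Type w) [TopologicalSpace M] [ChartedSpace (Euc m) M]
    (n : ℕ) (N : Type u) [TopologicalSpace N] [ChartedSpace (Euc n) N] :
    TopologicalSpace C^1⟮𝓡 m, M; 𝓡 n, N⟯ :=
  TopologicalSpace.generateFrom
    {B | ∃ (ι : Type w) (φ : ι → OpenPartialHomeomorph M (Euc m))
        (ψ : ι → OpenPartialHomeomorph N (Euc n)) (K : ι → Set M) (ε : ι → ℝ)
        (f : C^1⟮𝓡 m, M; 𝓡 n, N⟯),
      (∀ i, φ i ∈ IsManifold.maximalAtlas (𝓡 m) 1 M) ∧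
      LocallyFinite (fun i => (φ i).source) ∧
      (∀ i, ψ i ∈ IsManifold.maximalAtlas (𝓡 n) 1 N) ∧
      (∀ i, IsCompact (K i)) ∧ (∀ i, K i ⊆ (φ i).source) ∧
      (∀ i, MapsTo f (K i) (ψ i).source) ∧ (∀ i, 0 < ε i) ∧
      B = strongBasicSet φ ψ K ε f}

end Maps

end

end ThomRegularity

/-!
Whether `g` is transverse to the foliation at `q` depends only on the point `g q` and on the range
of the derivative of `g` at `q`, through the condition that this range and the tangent space at
`g q` of the leaf through `g q` span the tangent space of `N`.

If the stratification is regular, this condition is open. Suppose that `g` is transverse, and that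
maps `h k`, closer and closer to `g` near `q₀`, fail to be transverse at points `q k` tending to
`q₀`. As the strata form a locally finite family with closed union, the points `h k (q k)` may be
taken in one stratum `X`, and by compactness of the Grassmannian the leaf tangent spaces there
converge to a subspace `τ`. Regularity says that `τ` contains the leaf tangent space at `g q₀`, so
the range of the derivative of `g` at `q₀` spans with `τ`; as spanning is an open condition on a
linear map and a subspace, this contradicts the choice of the `h k`
(`IsThomRegular.exists_nhds_forall_transverse`). A locally finite cover by charts turns these local
estimates into a neighbourhood in the strong topology
(`IsThomRegular.isOpen_transverseToFoliation`).

Conversely, let leaf tangent spaces at points `x i` of `X` tend to a `τ` at `y` that does not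
contain the leaf tangent space of `Y`. In a chart at `y`, let `e` be a unit vector orthogonal to `τ`
but not to the leaf tangent space of `Y`. The map `x ↦ x - β(x) ⟪e, x⟫ e`, with `β` a radially
decreasing cutoff equal to `1` only at the origin, is a local diffeomorphism except at the origin,
where its derivative is the projection onto the hyperplane orthogonal to `e`. Extended by the
identity, it is a map `N → N` transverse to the foliation. Replacing `e` by unit vectors `e i → e`
orthogonal to the leaf tangent spaces at `x i`, and translating so that the origin goes to `x i`,
gives maps that are not transverse at `y` (`pinch`, `isThomRegular_of_isOpen`). They converge to the
first map in the strong topology, since they form a jointly `C¹` family that is constant outside a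
compact set (`tendsto_strongTopology`).
-/

namespace ThomRegularity

/-! ### Subspaces of Euclidean space and their orthogonal projections -/

/-- The Grassmannian is compact: every sequence of subspaces has a convergent subsequence. -/
lemma exists_subseq_tendsto_starProjection {E : Type*} [NormedAddCommGroup E]
    [InnerProductSpace ℝ E] [FiniteDimensional ℝ E] (L : ℕ → Submodule ℝ E) :
    ∃ (L₀ : Submodule ℝ E) (φ : ℕ → ℕ), StrictMono φ ∧
      Tendsto (fun k => (L (φ k)).starProjection) atTop (𝓝 L₀.starProjection) := by
  have hmem : ∀ k, (L k).starProjection ∈ Metric.closedBall (0 : E →L[ℝ] E) 1 := fun k => by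
    simpa using (L k).starProjection_norm_le
  obtain ⟨A, -, φ, hφ, hA⟩ :=
    tendsto_subseq_of_bounded (Metric.isBounded_closedBall (x := (0 : E →L[ℝ] E)) (r := 1)) hmem
  have hstar : IsStarProjection A := by
    constructor
    · have h2 := hA.mul hA
      refine tendsto_nhds_unique (h2.congr fun k => ?_) hA
      exact (isStarProjection_starProjection (U := L (φ k))).isIdempotentElem
    · have h2 := hA.star
      refine tendsto_nhds_unique (h2.congr fun k => ?_) hA
      exact (isStarProjection_starProjection (U := L (φ k))).isSelfAdjoint
  obtain ⟨_, hp⟩ := isStarProjection_iff_eq_starProjection_range.1 hstar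
  refine ⟨A.range, φ, hφ, ?_⟩
  rw [← hp]
  exact hA

/-- Surjectivity is an open condition on linear maps into a finite dimensional space. -/
lemma eventually_surjective {E F : Type*} [NormedAddCommGroup E] [NormedSpace ℝ E]
    [NormedAddCommGroup F] [NormedSpace ℝ F] [FiniteDimensional ℝ F] {A : E →L[ℝ] F}
    (hA : Function.Surjective A) : ∀ᶠ B : E →L[ℝ] F in 𝓝 A, Function.Surjective B := by
  obtain ⟨R, hR⟩ := A.toLinearMap.exists_rightInverse_of_surjective (LinearMap.range_eq_top.2 hA)
  let R' : F →L[ℝ] E := LinearMap.toContinuousLinearMap R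
  have hone : A.comp R' = 1 := by
    ext v
    exact LinearMap.congr_fun hR v
  have hcont : Tendsto (fun B : E →L[ℝ] F => B.comp R') (𝓝 A) (𝓝 1) := by
    rw [← hone]
    exact ((ContinuousLinearMap.compL ℝ F E F).flip R').continuous.tendsto A
  have hunit : ∀ᶠ C in 𝓝 (1 : F →L[ℝ] F), IsUnit C := by
    have : CompleteSpace F := FiniteDimensional.complete ℝ F
    exact Units.isOpen.mem_nhds isUnit_one
  filter_upwards [hcont.eventually hunit] with B hB w
  obtain ⟨u, hu⟩ := hB
  refine ⟨R' ((↑u⁻¹ : F →L[ℝ] F) w), ?_⟩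
  have : ((u : F →L[ℝ] F) * (↑u⁻¹ : F →L[ℝ] F)) w = w := by simp
  rw [hu] at this
  exact this

/-- Transversality is an open condition on pairs consisting of a linear map and a subspace. -/
lemma eventually_range_sup_eq_top {ι E F : Type*} {l : Filter ι} [NormedAddCommGroup E]
    [NormedSpace ℝ E] [NormedAddCommGroup F] [InnerProductSpace ℝ F] [FiniteDimensional ℝ F]
    {D : ι → E →L[ℝ] F} {D₀ : E →L[ℝ] F} {L : ι → Submodule ℝ F} {L₀ : Submodule ℝ F}
    (hD : Tendsto D l (𝓝 D₀))
    (hL : Tendsto (fun k => (L k).starProjection) l (𝓝 L₀.starProjection))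
    (h : LinearMap.range D₀.toLinearMap ⊔ L₀ = ⊤) :
    ∀ᶠ k in l, LinearMap.range (D k).toLinearMap ⊔ L k = ⊤ := by
  -- `range D ⊔ L` is the range of the linear map `(v, w) ↦ D v + P_L w`
  have key : ∀ (A : E →L[ℝ] F) (K : Submodule ℝ F),
      LinearMap.range A.toLinearMap ⊔ K = ⊤ ↔
        Function.Surjective (A.coprod K.starProjection) := fun A K => by
    have hr : LinearMap.range (K.starProjection).toLinearMap = K := K.range_starProjection
    have hc : LinearMap.range (A.coprod K.starProjection).toLinearMap =
        LinearMap.range A.toLinearMap ⊔ K := by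
      rw [ContinuousLinearMap.range_coprod, hr]
    rw [← hc, LinearMap.range_eq_top]
    rfl
  rw [key] at h
  have hT : Tendsto (fun k => (D k).coprod (L k).starProjection) l
      (𝓝 (D₀.coprod L₀.starProjection)) := by
    have h1 := (((ContinuousLinearMap.compL ℝ (E × F) E F).flip
      (ContinuousLinearMap.fst ℝ E F)).continuous.tendsto D₀).comp hD
    have h2 := (((ContinuousLinearMap.compL ℝ (E × F) F F).flip
      (ContinuousLinearMap.snd ℝ E F)).continuous.tendsto _).comp hL
    have h3 := h1.add h2
    convert! h3 using 1
  filter_upwards [hT.eventually (eventually_surjective h)] with k hk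
  exact (key _ _).2 hk

/-! ### Transversality in charts -/

section Charts

variable {m n : ℕ} {M : Type w} [TopologicalSpace M] [ChartedSpace (Euc m) M]
  {N : Type u} [TopologicalSpace N] [ChartedSpace (Euc n) N] {P : Type v}

lemma mdifferentiable_of_mem_maximalAtlas {ψ : OpenPartialHomeomorph N (Euc n)}
    (hψ : ψ ∈ IsManifold.maximalAtlas (𝓡 n) 1 N) : ψ.MDifferentiable (𝓡 n) (𝓡 n) :=
  ⟨fun _ hx => (mdifferentiableAt_of_mem_maximalAtlas hψ hx).mdifferentiableWithinAt,
    fun _ hx => (mdifferentiableAt_symm_of_mem_maximalAtlas hψ hx).mdifferentiableWithinAt⟩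

/-- A leaf that contains `g q` is the leaf through `g q`, so one condition per point suffices. -/
lemma transverseToFoliation_iff {f : N → P} {Strata : Set (Set N)} {g : M → N} :
    TransverseToFoliation m n f Strata g ↔ ∀ S ∈ Strata, ∀ q : M, g q ∈ S →
      LinearMap.range (mfderiv (𝓡 m) (𝓡 n) g q).toLinearMap ⊔ leafTangent n f S (g q) = ⊤ := by
  constructor
  · intro h S hS q hq
    exact h S hS (g q) hq q (mem_connectedComponentIn ⟨hq, rfl⟩)
  · intro h S hS x _ q hmem
    have hsub := connectedComponentIn_subset _ _ hmem
    have heq : leaf f S (g q) = leaf f S x := by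
      have hfx : f (g q) = f x := hsub.2
      unfold leaf
      rw [hfx]
      exact (connectedComponentIn_eq hmem).symm
    have := h S hS q hsub.1
    rwa [leafTangent, heq] at this

lemma range_fderiv_chart {φ : OpenPartialHomeomorph M (Euc m)}
    {ψ : OpenPartialHomeomorph N (Euc n)} (hφ : φ ∈ IsManifold.maximalAtlas (𝓡 m) 1 M)
    (hψ : ψ ∈ IsManifold.maximalAtlas (𝓡 n) 1 N) {g : M → N} {q : M}
    (hg : MDifferentiableAt (𝓡 m) (𝓡 n) g q) (hq : q ∈ φ.source) (hgq : g q ∈ ψ.source) :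
    LinearMap.range (fderiv ℝ (ψ ∘ g ∘ φ.symm) (φ q)).toLinearMap =
      Submodule.map (mfderiv (𝓡 n) 𝓘(ℝ, Euc n) ψ (g q)).toLinearMap
        (LinearMap.range (mfderiv (𝓡 m) (𝓡 n) g q).toLinearMap) := by
  have hφd := mdifferentiable_of_mem_maximalAtlas hφ
  have hψd := mdifferentiable_of_mem_maximalAtlas hψ
  have hinv : φ.symm (φ q) = q := φ.left_inv hq
  have h1 : MDifferentiableAt (𝓡 m) (𝓡 m) φ.symm (φ q) :=
    hφd.mdifferentiableAt_symm (φ.map_source hq)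
  have e1 : mfderiv (𝓡 m) (𝓡 n) (ψ ∘ g ∘ φ.symm) (φ q) =
      (mfderiv (𝓡 n) (𝓡 n) ψ (g q)).comp ((mfderiv (𝓡 m) (𝓡 n) g q).comp
        (mfderiv (𝓡 m) (𝓡 m) φ.symm (φ q))) := by
    have h2 : HasMFDerivAt (𝓡 m) (𝓡 m) φ.symm (φ q) (mfderiv (𝓡 m) (𝓡 m) φ.symm (φ q)) :=
      h1.hasMFDerivAt
    have h3 : HasMFDerivAt (𝓡 m) (𝓡 n) g (φ.symm (φ q)) (mfderiv (𝓡 m) (𝓡 n) g q) := by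
      rw [hinv]; exact hg.hasMFDerivAt
    have h4 : HasMFDerivAt (𝓡 n) (𝓡 n) ψ ((g ∘ φ.symm) (φ q)) (mfderiv (𝓡 n) (𝓡 n) ψ (g q)) := by
      have : (g ∘ φ.symm) (φ q) = g q := congrArg g hinv
      rw [this]
      exact (hψd.mdifferentiableAt hgq).hasMFDerivAt
    exact (h4.comp (φ q) (h3.comp (φ q) h2)).mfderiv
  have hs : Function.Surjective (mfderiv (𝓡 m) (𝓡 m) φ.symm (φ q)) :=
    hφd.symm.mfderiv_surjective (φ.map_source hq)
  rw [mfderiv_eq_fderiv] at e1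
  rw [e1]
  ext v
  constructor
  · rintro ⟨w, rfl⟩
    exact ⟨_, ⟨_, rfl⟩, rfl⟩
  · rintro ⟨_, ⟨w, rfl⟩, rfl⟩
    obtain ⟨w', rfl⟩ := hs w
    exact ⟨w', rfl⟩

lemma range_mfderiv_sup_eq_top_iff {φ : OpenPartialHomeomorph M (Euc m)}
    {ψ : OpenPartialHomeomorph N (Euc n)} (hφ : φ ∈ IsManifold.maximalAtlas (𝓡 m) 1 M)
    (hψ : ψ ∈ IsManifold.maximalAtlas (𝓡 n) 1 N) {g : M → N} {q : M}
    (hg : MDifferentiableAt (𝓡 m) (𝓡 n) g q) (hq : q ∈ φ.source) (hgq : g q ∈ ψ.source)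
    (L : Submodule ℝ (TangentSpace (𝓡 n) (g q))) :
    LinearMap.range (mfderiv (𝓡 m) (𝓡 n) g q).toLinearMap ⊔ L = ⊤ ↔
      LinearMap.range (fderiv ℝ (ψ ∘ g ∘ φ.symm) (φ q)).toLinearMap ⊔
        (Submodule.map (mfderiv (𝓡 n) 𝓘(ℝ, Euc n) ψ (g q)).toLinearMap L :
          Submodule ℝ (Euc n)) = ⊤ := by
  have hb := (mdifferentiable_of_mem_maximalAtlas hψ).mfderiv_bijective hgq
  rw [range_fderiv_chart hφ hψ hg hq hgq]
  have h1 := Submodule.map_sup (LinearMap.range (mfderiv (𝓡 m) (𝓡 n) g q).toLinearMap) L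
    (mfderiv (𝓡 n) 𝓘(ℝ, Euc n) ψ (g q)).toLinearMap
  have h2 : Submodule.map (mfderiv (𝓡 n) 𝓘(ℝ, Euc n) ψ (g q)).toLinearMap ⊤ = ⊤ := by
    rw [Submodule.map_top]; exact LinearMap.range_eq_top.2 hb.2
  constructor
  · intro h
    rw [h, h2] at h1
    exact h1.symm
  · intro h
    apply Submodule.map_injective_of_injective
      (f := (mfderiv (𝓡 n) 𝓘(ℝ, Euc n) ψ (g q)).toLinearMap) hb.1
    rw [h2]
    exact h1.trans h

end Charts

/-! ### Continuity of chart derivatives and convergence in the strong topology -/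

section StrongTopology

variable {m n : ℕ} {M : Type w} [TopologicalSpace M] [ChartedSpace (Euc m) M]
  {N : Type u} [TopologicalSpace N] [ChartedSpace (Euc n) N]

/-- The derivative, in charts, of a jointly `C¹` family of maps depends continuously on the
parameter and on the point. -/
lemma continuousAt_fderiv_chart {S : Type*} [NormedAddCommGroup S] [NormedSpace ℝ S]
    {γ : S → M → N} {s₀ : S} {q₀ : M}
    (hγ : ContMDiffAt (𝓘(ℝ, S).prod (𝓡 m)) (𝓡 n) 1 (fun z : S × M => γ z.1 z.2) (s₀, q₀))
    {φ : OpenPartialHomeomorph M (Euc m)} {ψ : OpenPartialHomeomorph N (Euc n)}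
    (hφ : φ ∈ IsManifold.maximalAtlas (𝓡 m) 1 M) (hψ : ψ ∈ IsManifold.maximalAtlas (𝓡 n) 1 N)
    (hq : q₀ ∈ φ.source) (hgq : γ s₀ q₀ ∈ ψ.source) :
    ContinuousAt (fun z : S × M => fderiv ℝ (ψ ∘ γ z.1 ∘ φ.symm) (φ z.2)) (s₀, q₀) := by
  let F : S × Euc m → Euc n := fun z => ψ (γ z.1 (φ.symm z.2))
  have hinv : φ.symm (φ q₀) = q₀ := φ.left_inv hq
  have hF : ContDiffAt ℝ 1 F (s₀, φ q₀) := by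
    rw [← contMDiffAt_iff_contDiffAt]
    have h1 : ContMDiffAt 𝓘(ℝ, S × Euc m) 𝓘(ℝ, S) 1 (Prod.fst : S × Euc m → S) (s₀, φ q₀) :=
      contDiff_fst.contMDiff.contMDiffAt
    have h2 : ContMDiffAt 𝓘(ℝ, S × Euc m) 𝓘(ℝ, Euc m) 1 (Prod.snd : S × Euc m → Euc m)
        (s₀, φ q₀) := contDiff_snd.contMDiff.contMDiffAt
    have h3 : ContMDiffAt 𝓘(ℝ, S × Euc m) (𝓡 m) 1 (fun z : S × Euc m => φ.symm z.2)
        (s₀, φ q₀) :=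
      ContMDiffAt.comp (I' := 𝓡 m) (s₀, φ q₀)
        (contMDiffAt_symm_of_mem_maximalAtlas hφ (φ.map_source hq)) h2
    have h4 : ContMDiffAt 𝓘(ℝ, S × Euc m) (𝓘(ℝ, S).prod (𝓡 m)) 1
        (fun z : S × Euc m => (z.1, φ.symm z.2)) (s₀, φ q₀) := h1.prodMk h3
    have h5 : ContMDiffAt 𝓘(ℝ, S × Euc m) (𝓡 n) 1
        (fun z : S × Euc m => γ z.1 (φ.symm z.2)) (s₀, φ q₀) :=
      ContMDiffAt.comp_of_eq (g := fun z : S × M => γ z.1 z.2) hγ h4 (by simp [hinv])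
    exact ContMDiffAt.comp_of_eq (g := ψ) (contMDiffAt_of_mem_maximalAtlas hψ hgq) h5
      (by simp [hinv])
  have hφc : ContinuousAt (fun z : S × M => (z.1, φ z.2)) (s₀, q₀) :=
    continuousAt_fst.prodMk
      (ContinuousAt.comp (f := Prod.snd) (x := (s₀, q₀)) (φ.continuousAt hq) continuousAt_snd)
  have hdF : ContinuousAt (fderiv ℝ F) (s₀, φ q₀) :=
    (hF.fderiv_right (m := 0) (by norm_num)).continuousAt
  have hdiff : ∀ᶠ z in 𝓝 (s₀, φ q₀), DifferentiableAt ℝ F z :=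
    (hF.eventually (by simp)).mono fun z hz => hz.differentiableAt one_ne_zero
  have heq : (fun z : S × M => fderiv ℝ (ψ ∘ γ z.1 ∘ φ.symm) (φ z.2)) =ᶠ[𝓝 (s₀, q₀)]
      fun z => (fderiv ℝ F (z.1, φ z.2)).comp (ContinuousLinearMap.inr ℝ S (Euc m)) := by
    filter_upwards [hφc.eventually hdiff] with z hz
    exact (hz.hasFDerivAt.comp (φ z.2) (hasFDerivAt_prodMk_right z.1 (φ z.2))).fderiv
  have hc : ContinuousAt (fun z : S × M => fderiv ℝ F (z.1, φ z.2)) (s₀, q₀) :=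
    ContinuousAt.comp (f := fun z : S × M => (z.1, φ z.2)) (x := (s₀, q₀)) hdF hφc
  exact (hc.clm_comp continuousAt_const).congr heq.symm

lemma contMDiffAt_const_family {S : Type*} [NormedAddCommGroup S] [NormedSpace ℝ S]
    (h : C^1⟮𝓡 m, M; 𝓡 n, N⟯) (s₀ : S) (q₀ : M) :
    ContMDiffAt (𝓘(ℝ, S).prod (𝓡 m)) (𝓡 n) 1
      (fun z : S × M => (fun _ : S => (h : M → N)) z.1 z.2) (s₀, q₀) :=
  (h.contMDiff.comp contMDiff_snd).contMDiffAt

/-- A jointly `C¹` family of maps that is constant outside a compact set is continuous in the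
strong topology. -/
lemma tendsto_strongTopology {S : Type*} [NormedAddCommGroup S] [NormedSpace ℝ S]
    {γ : S → C^1⟮𝓡 m, M; 𝓡 n, N⟯} {s₀ : S}
    (hγ : ∀ q, ContMDiffAt (𝓘(ℝ, S).prod (𝓡 m)) (𝓡 n) 1 (fun z : S × M => γ z.1 z.2) (s₀, q))
    {C : Set M} (hC : IsCompact C) (hconst : ∀ s, ∀ q ∉ C, γ s q = γ s₀ q) :
    Tendsto γ (𝓝 s₀) (@nhds _ (strongTopology m M n N) (γ s₀)) := by
  rw [TopologicalSpace.tendsto_nhds_generateFrom_iff]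
  rintro B ⟨ι, φ, ψ, K, ε, h, hφ, hfin, hψ, hK, hKφ, hhK, -, rfl⟩ h0
  have hmeet := hfin.finite_nonempty_inter_compact hC
  have hclose : ∀ᶠ s in 𝓝 s₀, ∀ i ∈ {i | ((φ i).source ∩ C).Nonempty}, ∀ q ∈ K i,
      γ s q ∈ (ψ i).source ∧ ‖ψ i (h q) - ψ i (γ s q)‖ < ε i ∧
      ‖fderiv ℝ (ψ i ∘ h ∘ (φ i).symm) (φ i q) -
        fderiv ℝ (ψ i ∘ γ s ∘ (φ i).symm) (φ i q)‖ < ε i := by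
    rw [eventually_all_finite hmeet]
    intro i _
    refine (hK i).eventually_forall_of_forall_eventually fun q hq => ?_
    have hγq : γ s₀ q ∈ (ψ i).source := (h0 i).1 hq
    have hhq : h q ∈ (ψ i).source := hhK i hq
    have hγc : ContinuousAt (fun z : S × M => γ z.1 z.2) (s₀, q) := (hγ q).continuousAt
    have hhc : ContinuousAt (fun z : S × M => h z.2) (s₀, q) :=
      (contMDiffAt_const_family h s₀ q).continuousAt
    have c1 : ContinuousAt (fun z : S × M => ‖ψ i (h z.2) - ψ i (γ z.1 z.2)‖) (s₀, q) :=
      ((ContinuousAt.comp (f := fun z : S × M => h z.2) (x := (s₀, q))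
        ((ψ i).continuousAt hhq) hhc).sub
      (ContinuousAt.comp (f := fun z : S × M => γ z.1 z.2) (x := (s₀, q))
        ((ψ i).continuousAt hγq) hγc)).norm
    have c2 := ((continuousAt_fderiv_chart (γ := fun _ : S => (h : M → N))
      (contMDiffAt_const_family h s₀ q) (hφ i) (hψ i)
      (hKφ i hq) hhq).sub
      (continuousAt_fderiv_chart (γ := fun s => (γ s : M → N)) (hγ q) (hφ i) (hψ i)
        (hKφ i hq) hγq)).norm
    filter_upwards [hγc.eventually ((ψ i).open_source.mem_nhds hγq),
      c1.eventually (gt_mem_nhds ((h0 i).2 q hq).1),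
      c2.eventually (gt_mem_nhds ((h0 i).2 q hq).2)] with z z1 z2 z3
    exact ⟨z1, z2, z3⟩
  filter_upwards [hclose] with s hs i
  by_cases hi : ((φ i).source ∩ C).Nonempty
  · exact ⟨fun q hq => (hs i hi q hq).1, fun q hq => (hs i hi q hq).2⟩
  · have heq : ∀ q ∈ (φ i).source, γ s q = γ s₀ q := fun q hq =>
      hconst s q fun hqC => hi ⟨q, hq, hqC⟩
    refine ⟨fun q hq => ?_, fun q hq => ?_⟩
    · rw [heq q (hKφ i hq)]
      exact (h0 i).1 hq
    · have hfd : fderiv ℝ (ψ i ∘ γ s ∘ (φ i).symm) (φ i q) =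
          fderiv ℝ (ψ i ∘ γ s₀ ∘ (φ i).symm) (φ i q) := by
        apply Filter.EventuallyEq.fderiv_eq
        filter_upwards [(φ i).open_target.mem_nhds ((φ i).map_source (hKφ i hq))] with x hx
        exact congrArg (ψ i) (heq _ ((φ i).map_target hx))
      rw [heq q (hKφ i hq), hfd]
      exact (h0 i).2 q hq

end StrongTopology

/-! ### Regularity implies openness -/

section Openness

variable {m n : ℕ} {M : Type w} [TopologicalSpace M] [ChartedSpace (Euc m) M]
  [SecondCountableTopology M]

/-- Every point-dependent choice of neighbourhoods is refined by a locally finite family of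
restricted charts, together with compact sets in their domains that cover the manifold. -/
lemma exists_locallyFinite_chart_family [T2Space M] (W : M → Set M) (hW : ∀ q, W q ∈ 𝓝 q) :
    ∃ (ι : Type w) (c : ι → M) (B K : ι → Set M), (∀ i, IsOpen (B i)) ∧
      LocallyFinite B ∧ (∀ i, B i ⊆ W (c i)) ∧ (∀ i, B i ⊆ (chartAt (Euc m) (c i)).source) ∧
      (∀ i, IsCompact (K i)) ∧ (∀ i, K i ⊆ B i) ∧ ⋃ i, K i = univ := by
  have : LocallyCompactSpace M := ChartedSpace.locallyCompactSpace (Euc m) M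
  choose Z hZ hZW hZc using fun q => local_compact_nhds
    (inter_mem (hW q) ((chartAt (Euc m) q).open_source.mem_nhds (mem_chart_source _ q)))
  obtain ⟨ι, c, B, hB, hcov, hfin⟩ := refinement_of_locallyCompact_sigmaCompact_of_nhds_basis
    (fun q => (nhds_basis_opens q).restrict_subset (hZ q))
  obtain ⟨v, hv, -, hvB⟩ := exists_iUnion_eq_closure_subset (fun i => (hB i).1.2)
    hfin.point_finite hcov
  refine ⟨ι, c, B, fun i => closure (v i), fun i => (hB i).1.2, hfin,
    fun i => ((hB i).2.trans (hZW _)).trans inter_subset_left,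
    fun i => ((hB i).2.trans (hZW _)).trans inter_subset_right,
    fun i => (hZc (c i)).of_isClosed_subset isClosed_closure ((hvB i).trans (hB i).2), hvB, ?_⟩
  exact eq_univ_of_univ_subset (hv.symm.subset.trans (iUnion_mono fun i => subset_closure))

variable [IsManifold (𝓡 m) 1 M]
  {N : Type u} [TopologicalSpace N] [ChartedSpace (Euc n) N] [IsManifold (𝓡 n) 1 N]
  {P : Type v} {f : N → P} {V : Set N} {Strata : Set (Set N)}

/-- The local form of openness: if `g` is transverse to the foliation, then near `q₀` so is every
map whose value and derivative are close to those of `g`. Otherwise some sequence of points of a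
single stratum, with leaf tangent spaces converging to some `τ`, violates it in the limit, where
regularity says that `τ` contains a space to which `g` is transverse. -/
lemma IsThomRegular.exists_nhds_forall_transverse (hreg : IsThomRegular n f Strata)
    (hV : IsClosed V) (hStrata : IsPrestratification n V Strata)
    (g : C^1⟮𝓡 m, M; 𝓡 n, N⟯) (hg : TransverseToFoliation m n f Strata g) (q₀ : M) :
    ∃ U ∈ 𝓝 q₀, ∃ ε > 0, ∀ (h : C^1⟮𝓡 m, M; 𝓡 n, N⟯), ∀ q ∈ U,
      h q ∈ (chartAt (Euc n) (g q₀)).source →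
      ‖chartAt (Euc n) (g q₀) (g q) - chartAt (Euc n) (g q₀) (h q)‖ < ε →
      ‖fderiv ℝ (chartAt (Euc n) (g q₀) ∘ g ∘ (chartAt (Euc m) q₀).symm) (chartAt (Euc m) q₀ q) -
        fderiv ℝ (chartAt (Euc n) (g q₀) ∘ h ∘ (chartAt (Euc m) q₀).symm)
          (chartAt (Euc m) q₀ q)‖ < ε →
      ∀ S ∈ Strata, h q ∈ S →
        LinearMap.range (mfderiv (𝓡 m) (𝓡 n) h q).toLinearMap ⊔ leafTangent n f S (h q) = ⊤ := by
  by_contra hcon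
  push Not at hcon
  set y := g q₀ with hy
  set ψ := chartAt (Euc n) y
  set φ := chartAt (Euc m) q₀
  have hψ : ψ ∈ IsManifold.maximalAtlas (𝓡 n) 1 N := IsManifold.chart_mem_maximalAtlas y
  have hφ : φ ∈ IsManifold.maximalAtlas (𝓡 m) 1 M := IsManifold.chart_mem_maximalAtlas q₀
  have hyψ : y ∈ ψ.source := mem_chart_source _ y
  have hqφ : q₀ ∈ φ.source := mem_chart_source _ q₀
  obtain ⟨U, hU⟩ := (𝓝 q₀).exists_antitone_basis
  choose h q hqU hhψ hval hder S hS hhS hnot using fun k : ℕ =>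
    hcon (U k) (hU.1.mem_of_mem trivial) (1 / ((k : ℝ) + 1)) (by positivity)
  have hε : Tendsto (fun k : ℕ => 1 / ((k : ℝ) + 1)) atTop (𝓝 0) :=
    tendsto_one_div_add_atTop_nhds_zero_nat
  have hq : Tendsto q atTop (𝓝 q₀) := hU.tendsto hqU
  have hgq : Tendsto (fun k => ψ (g (q k))) atTop (𝓝 (ψ y)) :=
    (ψ.continuousAt hyψ).tendsto.comp ((g.contMDiff.continuous.tendsto q₀).comp hq)
  have hψh : Tendsto (fun k => ψ (h k (q k))) atTop (𝓝 (ψ y)) := by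
    refine hgq.congr_dist (squeeze_zero (fun _ => dist_nonneg) (fun k => ?_) hε)
    rw [dist_eq_norm]
    exact (hval k).le
  have hh : Tendsto (fun k => h k (q k)) atTop (𝓝 y) := by
    have h1 := (ψ.continuousAt_symm (ψ.map_source hyψ)).tendsto.comp hψh
    rw [ψ.left_inv hyψ] at h1
    exact h1.congr fun k => ψ.left_inv (hhψ k)
  have hD : Tendsto (fun k => fderiv ℝ (ψ ∘ h k ∘ φ.symm) (φ (q k))) atTop
      (𝓝 (fderiv ℝ (ψ ∘ g ∘ φ.symm) (φ q₀))) := by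
    have h1 : Tendsto (fun k => fderiv ℝ (ψ ∘ g ∘ φ.symm) (φ (q k))) atTop
        (𝓝 (fderiv ℝ (ψ ∘ g ∘ φ.symm) (φ q₀))) :=
      (continuousAt_fderiv_chart (γ := fun _ : ℝ => (g : M → N))
        (contMDiffAt_const_family g 0 q₀) hφ hψ hqφ hyψ).tendsto.comp
        (tendsto_const_nhds.prodMk_nhds hq)
    refine h1.congr_dist (squeeze_zero (fun _ => dist_nonneg) (fun k => ?_) hε)
    rw [dist_eq_norm]
    exact (hder k).le
  have hyV : y ∈ V := hV.mem_of_tendsto hh <| Eventually.of_forall fun k => by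
    rw [← hStrata.sUnion_eq]
    exact ⟨S k, hS k, hhS k⟩
  obtain ⟨Y, hY, hyY⟩ : ∃ Y ∈ Strata, y ∈ Y := by
    rwa [← hStrata.sUnion_eq] at hyV
  -- local finiteness: infinitely many of the points lie in the same stratum `X`
  obtain ⟨X, hX, hXf⟩ : ∃ X ∈ Strata, ∃ᶠ k in atTop, S k = X := by
    obtain ⟨W, hW, hfin⟩ := hStrata.locallyFinite y hyV
    by_contra hne
    push Not at hne
    have h1 := (eventually_all_finite hfin (l := atTop) (p := fun X k => S k ≠ X)).2
      fun X hX => hne X hX.1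
    obtain ⟨k, hk, hkW⟩ := (h1.and (hh.eventually hW)).exists
    exact hk (S k) ⟨hS k, h k (q k), hhS k, hkW⟩ rfl
  obtain ⟨σ, hσ, hσX⟩ := extraction_of_frequently_atTop hXf
  let L : ℕ → Submodule ℝ (Euc n) := fun k =>
    Submodule.map (mfderiv (𝓡 n) 𝓘(ℝ, Euc n) ψ (h (σ k) (q (σ k)))).toLinearMap
      (leafTangent n f X (h (σ k) (q (σ k))))
  obtain ⟨L₀, ρ, hρ, hL⟩ := exists_subseq_tendsto_starProjection L
  have hlim : Tendsto (fun k => σ (ρ k)) atTop atTop := hσ.tendsto_atTop.comp hρ.tendsto_atTop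
  let τ : Submodule ℝ (TangentSpace (𝓡 n) y) :=
    Submodule.comap (mfderiv (𝓡 n) 𝓘(ℝ, Euc n) ψ y).toLinearMap L₀
  have hτ : Submodule.map (mfderiv (𝓡 n) 𝓘(ℝ, Euc n) ψ y).toLinearMap τ = L₀ :=
    Submodule.map_comap_eq_of_surjective
      ((mdifferentiable_of_mem_maximalAtlas hψ).mfderiv_surjective hyψ) L₀
  have hXmem : ∀ k, h (σ (ρ k)) (q (σ (ρ k))) ∈ X := fun k => by
    have := hhS (σ (ρ k))
    rwa [hσX] at this
  have hle : leafTangent n f Y y ≤ τ := by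
    refine hreg X hX Y hY y ⟨hyY, mem_closure_of_tendsto (hh.comp hlim)
      (Eventually.of_forall hXmem)⟩ _ hXmem (hh.comp hlim) τ ⟨hh.comp hlim, ?_⟩
    have hL' := hL
    rw [← hτ] at hL'
    exact hL'
  have htop : LinearMap.range (fderiv ℝ (ψ ∘ g ∘ φ.symm) (φ q₀)).toLinearMap ⊔ L₀ = ⊤ := by
    have h1 := (range_mfderiv_sup_eq_top_iff hφ hψ (g.contMDiff.mdifferentiable one_ne_zero q₀)
      hqφ hyψ _).1
      (transverseToFoliation_iff.1 hg Y hY q₀ hyY)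
    rw [eq_top_iff, ← h1, ← hτ]
    exact sup_le_sup_left (Submodule.map_mono hle) _
  obtain ⟨k, hk, hkφ⟩ := ((eventually_range_sup_eq_top (hD.comp hlim) hL htop).and
    ((hq.comp hlim).eventually (φ.open_source.mem_nhds hqφ))).exists
  apply hnot (σ (ρ k))
  rw [hσX]
  exact (range_mfderiv_sup_eq_top_iff hφ hψ
    ((h (σ (ρ k))).contMDiff.mdifferentiable one_ne_zero _) hkφ (hhψ _) _).2 hk

lemma IsThomRegular.isOpen_transverseToFoliation [T2Space M] (hreg : IsThomRegular n f Strata)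
    (hV : IsClosed V) (hStrata : IsPrestratification n V Strata) :
    IsOpen[strongTopology m M n N]
      {g : C^1⟮𝓡 m, M; 𝓡 n, N⟯ | TransverseToFoliation m n f Strata g} := by
  refine (@isOpen_iff_forall_mem_open _ (strongTopology m M n N) _).2 fun g hg => ?_
  choose U hU ε hε hloc using hreg.exists_nhds_forall_transverse hV hStrata g hg
  obtain ⟨ι, c, B, K, hBo, hfin, hBW, hBs, hKc, hKB, hcov⟩ := exists_locallyFinite_chart_family
    (m := m) (fun q => U q ∩ g ⁻¹' (chartAt (Euc n) (g q)).source) fun q =>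
      inter_mem (hU q) (g.contMDiff.continuous.continuousAt.preimage_mem_nhds
        ((chartAt (Euc n) (g q)).open_source.mem_nhds (mem_chart_source _ _)))
  let φ : ι → OpenPartialHomeomorph M (Euc m) := fun i => (chartAt (Euc m) (c i)).restr (B i)
  let ψ : ι → OpenPartialHomeomorph N (Euc n) := fun i => chartAt (Euc n) (g (c i))
  have hsource : ∀ i, (φ i).source = B i := fun i => by
    rw [OpenPartialHomeomorph.restr_source, (hBo i).interior_eq, inter_eq_right.2 (hBs i)]
  refine ⟨strongBasicSet φ ψ K (fun i => ε (c i)) g, ?_, ?_, ?_⟩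
  · intro h hh
    refine transverseToFoliation_iff.2 fun S hS q hqS => ?_
    obtain ⟨i, hi⟩ := mem_iUnion.1 (hcov.symm.subset (mem_univ q))
    exact hloc (c i) h q (hBW i (hKB i hi)).1 ((hh i).1 hi) ((hh i).2 q hi).1 ((hh i).2 q hi).2
      S hS hqS
  · refine TopologicalSpace.isOpen_generateFrom_of_mem ⟨ι, φ, ψ, K, fun i => ε (c i), g,
      fun i => restr_mem_maximalAtlas _ (IsManifold.chart_mem_maximalAtlas _) (hBo i), ?_,
      fun i => IsManifold.chart_mem_maximalAtlas _, hKc, fun i => ?_,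
      fun i q hq => (hBW i (hKB i hq)).2, fun i => hε _, rfl⟩
    · simpa only [hsource] using hfin
    · rw [hsource]
      exact hKB i
  · intro i
    refine ⟨fun q hq => (hBW i (hKB i hq)).2, fun q _ => ?_⟩
    simpa using hε (c i)

end Openness

/-! ### A map of Euclidean space with a single critical point -/

section Pinch

open scoped RealInnerProductSpace

/-- A `C¹` cutoff function: it is `1` at `0`, less than `1` and nonincreasing on `(0, ∞)`, and `0`
on `[1, ∞)`. -/
def cutoff (t : ℝ) : ℝ := max (1 - t) 0 ^ 2

lemma hasDerivAt_cutoff (t : ℝ) : HasDerivAt cutoff (-(2 * max (1 - t) 0)) t := by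
  rcases lt_trichotomy t 1 with h | h | h
  · have h1 : HasDerivAt (fun t : ℝ => (1 - t) ^ 2) (-(2 * max (1 - t) 0)) t := by
      rw [max_eq_left (by linarith)]
      convert! ((hasDerivAt_id t).const_sub 1).pow 2 using 1
      simp
    refine h1.congr_of_eventuallyEq ?_
    filter_upwards [gt_mem_nhds h] with r hr
    rw [cutoff, max_eq_left (by linarith)]
  · subst h
    rw [hasDerivAt_iff_isLittleO]
    have h1 : (fun r : ℝ => (r - 1) ^ 2) =o[𝓝 1] fun r => r - 1 := by
      have h2 : Tendsto (fun r : ℝ => r - 1) (𝓝 1) (𝓝 0) := by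
        have : Continuous fun r : ℝ => r - 1 := by fun_prop
        simpa using this.tendsto 1
      exact (Asymptotics.isLittleO_pow_id one_lt_two).comp_tendsto h2
    refine (Asymptotics.isBigO_of_le _ fun r => ?_).trans_isLittleO h1
    simp only [cutoff, sub_self, max_self, Real.norm_eq_abs]
    have h3 : |max (1 - r) 0| ≤ |r - 1| := by
      rw [abs_of_nonneg (le_max_right _ _), abs_sub_comm]
      exact max_le (le_abs_self _) (abs_nonneg _)
    simpa [abs_pow] using pow_le_pow_left₀ (abs_nonneg _) h3 2
  · have h1 : HasDerivAt (fun _ : ℝ => (0 : ℝ)) (-(2 * max (1 - t) 0)) t := by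
      rw [max_eq_right (by linarith)]
      simpa using hasDerivAt_const t (0 : ℝ)
    refine h1.congr_of_eventuallyEq ?_
    filter_upwards [lt_mem_nhds h] with r hr
    rw [cutoff, max_eq_right (by linarith)]
    norm_num

lemma contDiff_cutoff : ContDiff ℝ 1 cutoff := by
  rw [contDiff_one_iff_deriv]
  refine ⟨fun t => (hasDerivAt_cutoff t).differentiableAt, ?_⟩
  have : deriv cutoff = fun t => -(2 * max (1 - t) 0) := funext fun t => (hasDerivAt_cutoff t).deriv
  rw [this]
  fun_prop

lemma cutoff_nonneg (t : ℝ) : 0 ≤ cutoff t := sq_nonneg _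

lemma cutoff_zero : cutoff 0 = 1 := by norm_num [cutoff]

lemma cutoff_le_one {t : ℝ} (ht : 0 ≤ t) : cutoff t ≤ 1 :=
  pow_le_one₀ (le_max_right _ _) (max_le (by linarith) zero_le_one)

lemma cutoff_lt_one {t : ℝ} (ht : 0 < t) : cutoff t < 1 :=
  pow_lt_one₀ (le_max_right _ _) (max_lt (by linarith) zero_lt_one) two_ne_zero

lemma cutoff_of_one_le {t : ℝ} (ht : 1 ≤ t) : cutoff t = 0 := by
  rw [cutoff, max_eq_right (by linarith)]
  norm_num

variable {E : Type*} [NormedAddCommGroup E] [InnerProductSpace ℝ E]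

/-- For `s = (e, a)`, the map that equals the identity outside the ball of radius `R` about `c` and
near `c` approximates the translate by `a` of the orthogonal projection along the unit vector `e`.
It takes `c` to `c + a`, and its derivative at `c` is that projection. -/
noncomputable def pinch (c : E) (R : ℝ) (s : E × E) (x : E) : E :=
  x - cutoff (‖x - c‖ ^ 2 / R ^ 2) • (⟪s.1, x - c⟫ • s.1 - s.2)

lemma contDiff_pinch (c : E) (R : ℝ) : ContDiff ℝ 1 fun z : (E × E) × E => pinch c R z.1 z.2 := by
  have h1 : ContDiff ℝ 1 fun z : (E × E) × E => z.2 - c := contDiff_snd.sub contDiff_const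
  have h2 : ContDiff ℝ 1 fun z : (E × E) × E => z.1.1 := contDiff_fst.comp contDiff_fst
  have h3 : ContDiff ℝ 1 fun z : (E × E) × E => z.1.2 := contDiff_snd.comp contDiff_fst
  exact contDiff_snd.sub ((contDiff_cutoff.comp ((h1.norm_sq ℝ).div_const _)).smul
    (((h2.inner ℝ h1).smul h2).sub h3))

lemma pinch_center (c : E) (R : ℝ) (s : E × E) : pinch c R s c = c + s.2 := by
  simp [pinch, cutoff_zero]

lemma pinch_of_le_norm {c : E} {R : ℝ} (hR : 0 < R) (s : E × E) {x : E} (hx : R ≤ ‖x - c‖) :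
    pinch c R s x = x := by
  have : 1 ≤ ‖x - c‖ ^ 2 / R ^ 2 := by
    rw [one_le_div (by positivity)]
    exact pow_le_pow_left₀ hR.le hx 2
  simp [pinch, cutoff_of_one_le this]

/-- For parameters near `(e, 0)` with `e` a unit vector, `pinch` moves a point of the ball by at most
`‖s.1‖ ^ 2 * R + ‖s.2‖ < 5 * R`, so a chart containing a ball of radius `7 * R` has room for it. -/
lemma pinch_mem_ball {c : E} {R : ℝ} {s : E × E} {x : E} (hs1 : ‖s.1‖ < 2)
    (hs2 : ‖s.2‖ < R) (hx : ‖x - c‖ ≤ R) : pinch c R s x ∈ Metric.ball c (7 * R) := by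
  have hR : 0 < R := (norm_nonneg _).trans_lt hs2
  rw [mem_ball_iff_norm]
  have h0 : cutoff (‖x - c‖ ^ 2 / R ^ 2) ≤ 1 := cutoff_le_one (by positivity)
  have h1 : ‖⟪s.1, x - c⟫ • s.1‖ ≤ 4 * R := by
    rw [norm_smul]
    calc ‖⟪s.1, x - c⟫‖ * ‖s.1‖ ≤ (‖s.1‖ * ‖x - c‖) * ‖s.1‖ := by
          gcongr; exact norm_inner_le_norm _ _
      _ ≤ (2 * R) * 2 := by gcongr
      _ = 4 * R := by ring
  have h2 : ‖cutoff (‖x - c‖ ^ 2 / R ^ 2) • (⟪s.1, x - c⟫ • s.1 - s.2)‖ ≤ 5 * R := by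
    rw [norm_smul, Real.norm_of_nonneg (cutoff_nonneg _)]
    calc _ ≤ 1 * ‖⟪s.1, x - c⟫ • s.1 - s.2‖ := by gcongr
      _ ≤ 4 * R + R := by
          rw [one_mul]
          exact (norm_sub_le _ _).trans (add_le_add h1 hs2.le)
      _ = 5 * R := by ring
  calc ‖pinch c R s x - c‖
      = ‖(x - c) - cutoff (‖x - c‖ ^ 2 / R ^ 2) • (⟪s.1, x - c⟫ • s.1 - s.2)‖ := by
        rw [pinch]; congr 1; abel
    _ ≤ R + 5 * R := (norm_sub_le _ _).trans (add_le_add hx h2)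
    _ < 7 * R := by linarith

lemma hasFDerivAt_pinch (c : E) (R : ℝ) (s : E × E) (x : E) :
    HasFDerivAt (pinch c R s) (ContinuousLinearMap.id ℝ E -
      (cutoff (‖x - c‖ ^ 2 / R ^ 2) • (innerSL ℝ s.1).smulRight s.1 +
        ((-(2 * max (1 - ‖x - c‖ ^ 2 / R ^ 2) 0) * (R ^ 2)⁻¹) •
          (2 • innerSL ℝ (x - c))).smulRight (⟪s.1, x - c⟫ • s.1 - s.2))) x := by
  have h1 : HasFDerivAt (fun x : E => x - c) (ContinuousLinearMap.id ℝ E) x :=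
    (hasFDerivAt_id x).sub_const c
  have h2 : HasFDerivAt (fun x : E => ‖x - c‖ ^ 2 / R ^ 2)
      ((R ^ 2)⁻¹ • (2 • innerSL ℝ (x - c))) x := by
    have := (h1.norm_sq).mul_const ((R ^ 2)⁻¹)
    simpa [div_eq_mul_inv] using this
  have h3 := (hasDerivAt_cutoff (‖x - c‖ ^ 2 / R ^ 2)).comp_hasFDerivAt x h2
  have h4 : HasFDerivAt (fun x : E => ⟪s.1, x - c⟫ • s.1 - s.2)
      ((innerSL ℝ s.1).smulRight s.1) x := by
    have h5 : HasFDerivAt (fun x : E => ⟪s.1, x - c⟫) (innerSL ℝ s.1) x := by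
      simpa [Function.comp_def] using ((innerSL ℝ s.1).hasFDerivAt (x := x - c)).comp x h1
    exact (h5.smul_const s.1).sub_const s.2
  have h6 := (hasFDerivAt_id x).sub (h3.smul h4)
  rw [smul_smul] at h6
  exact h6

lemma fderiv_pinch_center (c : E) (R : ℝ) (s : E × E) (v : E) :
    fderiv ℝ (pinch c R s) c v = v - ⟪s.1, v⟫ • s.1 := by
  rw [(hasFDerivAt_pinch c R s c).fderiv]
  simp [cutoff_zero]

/-- The derivative is `v ↦ v - ℓ v • e` with `ℓ e < 1`, because the cutoff decreases away from `c`
and is less than `1` there. -/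
lemma surjective_fderiv_pinch {c : E} {R : ℝ} (hR : 0 < R) {e : E} (he : ‖e‖ = 1) {x : E}
    (hx : x ≠ c) : Function.Surjective (fderiv ℝ (pinch c R (e, 0)) x) := by
  set b := cutoff (‖x - c‖ ^ 2 / R ^ 2) with hb
  set d := -(2 * max (1 - ‖x - c‖ ^ 2 / R ^ 2) 0) * (R ^ 2)⁻¹ with hd
  let ℓ : E → ℝ := fun v => b * ⟪e, v⟫ + d * (2 * ⟪x - c, v⟫) * ⟪e, x - c⟫
  have hform : ∀ v, fderiv ℝ (pinch c R (e, 0)) x v = v - ℓ v • e := fun v => by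
    rw [(hasFDerivAt_pinch c R (e, 0) x).fderiv]
    simp [ℓ, ← hb, ← hd, add_smul, smul_smul, mul_assoc, inner_sub_left]
  have hb1 : b < 1 := cutoff_lt_one (by
    have : 0 < ‖x - c‖ := norm_pos_iff.2 (sub_ne_zero.2 hx)
    positivity)
  have hd0 : d ≤ 0 := by
    have h1 : 0 ≤ max (1 - ‖x - c‖ ^ 2 / R ^ 2) 0 := le_max_right _ _
    have h2 : 0 < (R ^ 2)⁻¹ := by positivity
    rw [hd, neg_mul]
    exact neg_nonpos.2 (by positivity)
  have hℓe : ℓ e < 1 := by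
    have h1 : ⟪e, e⟫ = 1 := by rw [real_inner_self_eq_norm_sq, he]; norm_num
    have h2 : ℓ e = b + 2 * (d * ⟪e, x - c⟫ ^ 2) := by
      simp only [ℓ, h1, real_inner_comm e (x - c)]
      ring
    have h3 : d * ⟪e, x - c⟫ ^ 2 ≤ 0 := mul_nonpos_of_nonpos_of_nonneg hd0 (sq_nonneg _)
    linarith
  intro w
  refine ⟨w + (ℓ w / (1 - ℓ e)) • e, ?_⟩
  have hadd : ℓ (w + (ℓ w / (1 - ℓ e)) • e) = ℓ w + ℓ w / (1 - ℓ e) * ℓ e := by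
    simp only [ℓ, inner_add_right, inner_smul_right]
    ring
  have hval : ℓ w + ℓ w / (1 - ℓ e) * ℓ e = ℓ w / (1 - ℓ e) := by
    have : 1 - ℓ e ≠ 0 := by linarith
    field_simp
    ring
  rw [hform, hadd, hval, add_sub_cancel_right]

end Pinch

/-! ### Openness implies regularity -/

section Necessity

open scoped RealInnerProductSpace

variable {n : ℕ} {N : Type u} [TopologicalSpace N] [ChartedSpace (Euc n) N]

open Classical in
/-- The map `pinch` around `ψ y`, read in the preferred chart `ψ` at `y` and extended by the
identity. -/
noncomputable def pinchMap (y : N) (R : ℝ) (s : Euc n × Euc n) (q : N) : N :=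
  if q ∈ (chartAt (Euc n) y).source then
    (chartAt (Euc n) y).symm (pinch (chartAt (Euc n) y y) R s (chartAt (Euc n) y q))
  else q

/-- The parameters for which `pinchMap` is `C¹`. -/
def pinchParams (n : ℕ) (R : ℝ) : Set (Euc n × Euc n) := {s | ‖s.1‖ < 2 ∧ ‖s.2‖ < R}

/-- The compact coordinate ball outside which `pinchMap` is the identity. -/
def pinchSupport (n : ℕ) {N : Type u} [TopologicalSpace N] [ChartedSpace (Euc n) N] (y : N)
    (R : ℝ) : Set N :=
  (chartAt (Euc n) y).symm '' Metric.closedBall (chartAt (Euc n) y y) R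

lemma isOpen_pinchParams (R : ℝ) : IsOpen (pinchParams n R) :=
  (isOpen_lt continuous_fst.norm continuous_const).inter
    (isOpen_lt continuous_snd.norm continuous_const)

variable {y : N} {R : ℝ}

lemma isCompact_pinchSupport
    (hball : Metric.closedBall (chartAt (Euc n) y y) R ⊆ (chartAt (Euc n) y).target) :
    IsCompact (pinchSupport n y R) :=
  (isCompact_closedBall _ _).image_of_continuousOn
    ((chartAt (Euc n) y).continuousOn_symm.mono hball)

lemma pinchMap_of_notMem_pinchSupport (hR : 0 < R) (s : Euc n × Euc n) {q : N}
    (hq : q ∉ pinchSupport n y R) : pinchMap y R s q = q := by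
  unfold pinchMap
  split_ifs with h
  · rw [pinch_of_le_norm hR, (chartAt (Euc n) y).left_inv h]
    by_contra hlt
    exact hq ⟨_, by simpa [dist_eq_norm] using (not_le.1 hlt).le, (chartAt (Euc n) y).left_inv h⟩
  · rfl

lemma pinch_mem_target (hR : 0 < R)
    (hball : Metric.closedBall (chartAt (Euc n) y y) (7 * R) ⊆ (chartAt (Euc n) y).target)
    {s : Euc n × Euc n} (hs : s ∈ pinchParams n R) {x : Euc n}
    (hx : x ∈ (chartAt (Euc n) y).target) :
    pinch (chartAt (Euc n) y y) R s x ∈ (chartAt (Euc n) y).target := by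
  rcases le_total R ‖x - chartAt (Euc n) y y‖ with h | h
  · rwa [pinch_of_le_norm hR s h]
  · exact hball (Metric.ball_subset_closedBall (pinch_mem_ball hs.1 hs.2 h))

lemma pinchMap_center (s : Euc n × Euc n) :
    pinchMap y R s y = (chartAt (Euc n) y).symm (chartAt (Euc n) y y + s.2) := by
  rw [pinchMap, if_pos (mem_chart_source _ y), pinch_center]

lemma pinchMap_mem_source (hR : 0 < R)
    (hball : Metric.closedBall (chartAt (Euc n) y y) (7 * R) ⊆ (chartAt (Euc n) y).target)
    {s : Euc n × Euc n} (hs : s ∈ pinchParams n R) {q : N}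
    (hq : q ∈ (chartAt (Euc n) y).source) : pinchMap y R s q ∈ (chartAt (Euc n) y).source := by
  rw [pinchMap, if_pos hq]
  exact (chartAt (Euc n) y).map_target
    (pinch_mem_target hR hball hs ((chartAt (Euc n) y).map_source hq))

lemma fderiv_chart_pinchMap (hR : 0 < R)
    (hball : Metric.closedBall (chartAt (Euc n) y y) (7 * R) ⊆ (chartAt (Euc n) y).target)
    {s : Euc n × Euc n} (hs : s ∈ pinchParams n R) {q : N}
    (hq : q ∈ (chartAt (Euc n) y).source) :
    fderiv ℝ (chartAt (Euc n) y ∘ pinchMap y R s ∘ (chartAt (Euc n) y).symm)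
      (chartAt (Euc n) y q) =
      fderiv ℝ (pinch (chartAt (Euc n) y y) R s) (chartAt (Euc n) y q) := by
  apply Filter.EventuallyEq.fderiv_eq
  filter_upwards [(chartAt (Euc n) y).open_target.mem_nhds
    ((chartAt (Euc n) y).map_source hq)] with x hx
  simp only [Function.comp_apply]
  rw [pinchMap, if_pos ((chartAt (Euc n) y).map_target hx), (chartAt (Euc n) y).right_inv hx,
    (chartAt (Euc n) y).right_inv (pinch_mem_target hR hball hs hx)]

variable [IsManifold (𝓡 n) 1 N] [T2Space N]

lemma contMDiffAt_pinchMap (hR : 0 < R)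
    (hball : Metric.closedBall (chartAt (Euc n) y y) (7 * R) ⊆ (chartAt (Euc n) y).target)
    {s : Euc n × Euc n} (hs : s ∈ pinchParams n R) (q : N) :
    ContMDiffAt (𝓘(ℝ, Euc n × Euc n).prod (𝓡 n)) (𝓡 n) 1
      (fun z : (Euc n × Euc n) × N => pinchMap y R z.1 z.2) (s, q) := by
  set ψ := chartAt (Euc n) y with hψdef
  have hψ : ψ ∈ IsManifold.maximalAtlas (𝓡 n) 1 N := IsManifold.chart_mem_maximalAtlas y
  by_cases hq : q ∈ ψ.source
  · have h1 : ContMDiffAt (𝓘(ℝ, Euc n × Euc n).prod (𝓡 n)) 𝓘(ℝ, Euc n) 1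
        (fun z : (Euc n × Euc n) × N => ψ z.2) (s, q) :=
      ContMDiffAt.comp (I' := 𝓡 n) (s, q) (contMDiffAt_of_mem_maximalAtlas hψ hq) contMDiffAt_snd
    have h2 : ContMDiffAt (𝓘(ℝ, Euc n × Euc n).prod (𝓡 n)) 𝓘(ℝ, (Euc n × Euc n) × Euc n) 1
        (fun z : (Euc n × Euc n) × N => (z.1, ψ z.2)) (s, q) :=
      contMDiffAt_fst.prodMk_space h1
    have h3 : ContMDiffAt (𝓘(ℝ, Euc n × Euc n).prod (𝓡 n)) 𝓘(ℝ, Euc n) 1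
        (fun z : (Euc n × Euc n) × N => pinch (ψ y) R z.1 (ψ z.2)) (s, q) :=
      ContMDiffAt.comp (I' := 𝓘(ℝ, (Euc n × Euc n) × Euc n))
        (g := fun z : (Euc n × Euc n) × Euc n => pinch (ψ y) R z.1 z.2) (s, q)
        (contDiff_pinch (ψ y) R).contMDiff.contMDiffAt h2
    have h4 : ContMDiffAt (𝓘(ℝ, Euc n × Euc n).prod (𝓡 n)) (𝓡 n) 1
        (fun z : (Euc n × Euc n) × N => ψ.symm (pinch (ψ y) R z.1 (ψ z.2))) (s, q) :=
      ContMDiffAt.comp (I' := 𝓡 n) (g := ψ.symm) (s, q)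
        (contMDiffAt_symm_of_mem_maximalAtlas hψ
          (pinch_mem_target hR hball hs (ψ.map_source hq))) h3
    refine h4.congr_of_eventuallyEq ?_
    filter_upwards [continuousAt_snd.eventually (ψ.open_source.mem_nhds hq)] with z hz
    exact if_pos hz
  · have hK : IsClosed (pinchSupport n y R) := (isCompact_pinchSupport
      ((Metric.closedBall_subset_closedBall (by linarith)).trans hball)).isClosed
    have hqK : q ∉ pinchSupport n y R := by
      rintro ⟨x, hx, rfl⟩
      exact hq (ψ.map_target (hball (Metric.closedBall_subset_closedBall (by linarith) hx)))
    have h1 : ContMDiffAt (𝓘(ℝ, Euc n × Euc n).prod (𝓡 n)) (𝓡 n) 1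
        (fun z : (Euc n × Euc n) × N => z.2) (s, q) := contMDiffAt_snd
    refine h1.congr_of_eventuallyEq ?_
    filter_upwards [continuousAt_snd.eventually (hK.isOpen_compl.mem_nhds hqK)] with z hz
    exact pinchMap_of_notMem_pinchSupport hR _ hz

lemma contMDiff_pinchMap (hR : 0 < R)
    (hball : Metric.closedBall (chartAt (Euc n) y y) (7 * R) ⊆ (chartAt (Euc n) y).target)
    {s : Euc n × Euc n} (hs : s ∈ pinchParams n R) : ContMDiff (𝓡 n) (𝓡 n) 1 (pinchMap y R s) :=
  fun q => ContMDiffAt.comp (I' := 𝓘(ℝ, Euc n × Euc n).prod (𝓡 n))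
    (g := fun z : (Euc n × Euc n) × N => pinchMap y R z.1 z.2) (f := fun q => (s, q)) q
    (contMDiffAt_pinchMap hR hball hs q) (contMDiffAt_const.prodMk contMDiffAt_id)

open Classical in
/-- The maps `pinchMap` as a family in `C¹(N, N)`, the identity at parameters for which `pinchMap`
need not be `C¹`. -/
noncomputable def pinchFamily (hR : 0 < R)
    (hball : Metric.closedBall (chartAt (Euc n) y y) (7 * R) ⊆ (chartAt (Euc n) y).target)
    (s : Euc n × Euc n) : C^1⟮𝓡 n, N; 𝓡 n, N⟯ :=
  if hs : s ∈ pinchParams n R then ⟨pinchMap y R s, contMDiff_pinchMap hR hball hs⟩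
  else ContMDiffMap.id

lemma coe_pinchFamily (hR : 0 < R)
    (hball : Metric.closedBall (chartAt (Euc n) y y) (7 * R) ⊆ (chartAt (Euc n) y).target)
    {s : Euc n × Euc n} (hs : s ∈ pinchParams n R) :
    (pinchFamily hR hball s : N → N) = pinchMap y R s := by
  have h : pinchFamily hR hball s = ⟨pinchMap y R s, contMDiff_pinchMap hR hball hs⟩ := dif_pos hs
  rw [h]
  rfl

lemma tendsto_pinchFamily (hR : 0 < R)
    (hball : Metric.closedBall (chartAt (Euc n) y y) (7 * R) ⊆ (chartAt (Euc n) y).target)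
    {s₀ : Euc n × Euc n} (hs₀ : s₀ ∈ pinchParams n R) :
    Tendsto (pinchFamily hR hball) (𝓝 s₀)
      (@nhds _ (strongTopology n N n N) (pinchFamily hR hball s₀)) := by
  have hid : ∀ s, ∀ q ∉ pinchSupport n y R, pinchFamily hR hball s q = q := fun s q hq => by
    by_cases hs : s ∈ pinchParams n R
    · rw [coe_pinchFamily hR hball hs, pinchMap_of_notMem_pinchSupport hR s hq]
    · have h : pinchFamily hR hball s = ContMDiffMap.id := dif_neg hs
      rw [h]
      rfl
  refine tendsto_strongTopology (fun q => ?_) (isCompact_pinchSupport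
    ((Metric.closedBall_subset_closedBall (by linarith)).trans hball))
    fun s q hq => (hid s q hq).trans (hid s₀ q hq).symm
  refine (contMDiffAt_pinchMap hR hball hs₀ q).congr_of_eventuallyEq ?_
  filter_upwards [continuousAt_fst.eventually ((isOpen_pinchParams R).mem_nhds hs₀)] with z hz
  rw [coe_pinchFamily hR hball hz]

/-- Away from `y`, the map `pinchMap y R (e, 0)` is a local diffeomorphism. -/
lemma range_mfderiv_pinchMap (hR : 0 < R)
    (hball : Metric.closedBall (chartAt (Euc n) y y) (7 * R) ⊆ (chartAt (Euc n) y).target)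
    {e : Euc n} (he : ‖e‖ = 1) {q : N} (hq : q ≠ y) :
    LinearMap.range (mfderiv (𝓡 n) (𝓡 n) (pinchMap y R (e, 0)) q).toLinearMap = ⊤ := by
  have hs : (e, (0 : Euc n)) ∈ pinchParams n R := ⟨by simp [he], by simpa using hR⟩
  have hψ : chartAt (Euc n) y ∈ IsManifold.maximalAtlas (𝓡 n) 1 N :=
    IsManifold.chart_mem_maximalAtlas y
  by_cases hqs : q ∈ (chartAt (Euc n) y).source
  · rw [← sup_bot_eq (LinearMap.range _), range_mfderiv_sup_eq_top_iff hψ hψ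
      ((contMDiff_pinchMap hR hball hs).mdifferentiable one_ne_zero q) hqs
      (pinchMap_mem_source hR hball hs hqs), fderiv_chart_pinchMap hR hball hs hqs,
      LinearMap.range_eq_top.2 (surjective_fderiv_pinch hR he fun h =>
        hq ((chartAt (Euc n) y).injOn hqs (mem_chart_source _ y) h)), top_sup_eq]
  · have hK : IsClosed (pinchSupport n y R) := (isCompact_pinchSupport
      ((Metric.closedBall_subset_closedBall (by linarith)).trans hball)).isClosed
    have hqK : q ∉ pinchSupport n y R := by
      rintro ⟨x, hx, rfl⟩
      exact hqs ((chartAt (Euc n) y).map_target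
        (hball (Metric.closedBall_subset_closedBall (by linarith) hx)))
    have h1 : HasMFDerivAt (𝓡 n) (𝓡 n) (pinchMap y R (e, 0)) q
        (ContinuousLinearMap.id ℝ (TangentSpace (𝓡 n) q)) := by
      refine (hasMFDerivAt_id q).congr_of_eventuallyEq ?_
      filter_upwards [hK.isOpen_compl.mem_nhds hqK] with z hz
      exact pinchMap_of_notMem_pinchSupport hR _ hz
    rw [LinearMap.range_eq_top]
    intro w
    exact ⟨w, by rw [h1.mfderiv]; rfl⟩

variable {P : Type v} {f : N → P} {Strata : Set (Set N)}

/-- If a limit `τ` of leaf tangent spaces along `X` at `y` does not contain the leaf tangent space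
of `Y`, a hyperplane of `T_y N` contains the former and not the latter. The map `pinchMap` whose
derivative at `y` has this hyperplane as its range is transverse to the foliation, but it is a limit
of maps that send `y` into `X` with a derivative whose range lies in a hyperplane containing the
leaf tangent space of `X`. -/
lemma isThomRegular_of_isOpen (hdisj : Strata.PairwiseDisjoint id)
    (hO : IsOpen[strongTopology n N n N]
      {g : C^1⟮𝓡 n, N; 𝓡 n, N⟯ | TransverseToFoliation n n f Strata g}) :
    IsThomRegular n f Strata := by
  rintro X hX Y hY y ⟨hyY, -⟩ x hxX hx τ ⟨-, hτ⟩
  by_contra hle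
  obtain ⟨v, hvY, hvτ⟩ := SetLike.not_le_iff_exists.1 hle
  set ψ := chartAt (Euc n) y with hψdef
  have hψ : ψ ∈ IsManifold.maximalAtlas (𝓡 n) 1 N := IsManifold.chart_mem_maximalAtlas y
  have hyψ : y ∈ ψ.source := mem_chart_source _ y
  obtain ⟨r, hr, hrball⟩ := Metric.nhds_basis_closedBall.mem_iff.1
    (ψ.open_target.mem_nhds (ψ.map_source hyψ))
  have hR : 0 < r / 7 := by positivity
  have hball : Metric.closedBall (ψ y) (7 * (r / 7)) ⊆ ψ.target := by
    rwa [mul_div_cancel₀ r (by norm_num)]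
  -- leaf tangent spaces in the coordinates given by `ψ`
  let Λ : Set N → N → Submodule ℝ (Euc n) := fun S z =>
    Submodule.map (mfderiv (𝓡 n) 𝓘(ℝ, Euc n) ψ z).toLinearMap (leafTangent n f S z)
  let L₀ : Submodule ℝ (Euc n) := Submodule.map (mfderiv (𝓡 n) 𝓘(ℝ, Euc n) ψ y).toLinearMap τ
  have hlim : Tendsto (fun i => (Λ X (x i)).starProjection) atTop (𝓝 L₀.starProjection) := hτ
  let u : Euc n := mfderiv (𝓡 n) 𝓘(ℝ, Euc n) ψ y v
  have huY : u ∈ Λ Y y := ⟨v, hvY, rfl⟩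
  have huL : u ∉ L₀ := by
    rintro ⟨w, hw, hwu⟩
    have := (mdifferentiable_of_mem_maximalAtlas hψ).mfderiv_injective hyψ hwu
    exact hvτ (this ▸ hw)
  -- the component of `u` normal to a subspace, and its normalization
  let ν : (Euc n →L[ℝ] Euc n) → Euc n := fun A => u - A u
  have hν₀ : ν L₀.starProjection ≠ 0 := fun h =>
    huL (Submodule.starProjection_eq_self_iff.1 (sub_eq_zero.1 h).symm)
  have hνlim : Tendsto (fun i => ν (Λ X (x i)).starProjection) atTop
      (𝓝 (ν L₀.starProjection)) :=
    tendsto_const_nhds.sub (((ContinuousLinearMap.apply ℝ (Euc n) u).continuous.tendsto _).comp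
      hlim)
  let e : (Euc n →L[ℝ] Euc n) → Euc n := fun A => ‖ν A‖⁻¹ • ν A
  have he : ∀ A, ν A ≠ 0 → ‖e A‖ = 1 := fun A hA => by
    simp [e, norm_smul, norm_ne_zero_iff.2 hA]
  have helim : Tendsto (fun i => e (Λ X (x i)).starProjection) atTop
      (𝓝 (e L₀.starProjection)) :=
    (hνlim.norm.inv₀ (norm_ne_zero_iff.2 hν₀)).smul hνlim
  have horth : ∀ (L : Submodule ℝ (Euc n)), ∀ w ∈ L, ⟪e L.starProjection, w⟫ = 0 := by
    intro L w hw
    have h1 : ν L.starProjection ∈ Lᗮ := L.sub_starProjection_mem_orthogonal u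
    rw [inner_smul_left, Submodule.inner_left_of_mem_orthogonal hw h1, mul_zero]
  set e₀ := e L₀.starProjection with he₀def
  have he₀ : ‖e₀‖ = 1 := he _ hν₀
  have heu : ⟪e₀, u⟫ ≠ 0 := by
    have h1 : u = ν L₀.starProjection + L₀.starProjection u := (sub_add_cancel _ _).symm
    rw [h1, inner_add_right, horth L₀ _ (L₀.starProjection_apply_mem u), add_zero,
      inner_smul_left, real_inner_self_eq_norm_sq]
    have := norm_ne_zero_iff.2 hν₀
    simpa using this
  have hs₀ : (e₀, (0 : Euc n)) ∈ pinchParams n (r / 7) := ⟨by simp [he₀], by simpa using hR⟩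
  have hmem : TransverseToFoliation n n f Strata (pinchFamily hR hball (e₀, 0)) := by
    rw [coe_pinchFamily hR hball hs₀, transverseToFoliation_iff]
    intro S hS q hqS
    by_cases hq : q = y
    · subst hq
      have hfix : pinchMap q (r / 7) (e₀, 0) q = q := by
        rw [pinchMap_center, add_zero]
        exact ψ.left_inv hyψ
      have hSY : S = Y := by
        by_contra hne
        rw [hfix] at hqS
        exact (Set.disjoint_left.1 (hdisj hS hY hne)) hqS hyY
      subst hSY
      rw [range_mfderiv_sup_eq_top_iff hψ hψ
        ((contMDiff_pinchMap hR hball hs₀).mdifferentiable one_ne_zero q) hyψ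
        (pinchMap_mem_source hR hball hs₀ hyψ), fderiv_chart_pinchMap hR hball hs₀ hyψ]
      change _ ⊔ Λ S (pinchMap q (r / 7) (e₀, 0) q) = ⊤
      rw [hfix, eq_top_iff]
      rintro w -
      -- subtract the multiple of `u` that makes `w` orthogonal to `e₀`
      set t := ⟪e₀, w⟫ / ⟪e₀, u⟫ with ht
      refine Submodule.mem_sup.2 ⟨w - t • u, ⟨w - t • u, ?_⟩, t • u,
        Submodule.smul_mem _ _ huY, sub_add_cancel _ _⟩
      have h1 : ⟪e₀, w - t • u⟫ = 0 := by
        rw [inner_sub_right, inner_smul_right, ht, div_mul_cancel₀ _ heu, sub_self]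
      have h2 := fderiv_pinch_center (ψ q) (r / 7) (e₀, (0 : Euc n)) (w - t • u)
      rw [h1, zero_smul, sub_zero] at h2
      exact h2
    · rw [range_mfderiv_pinchMap hR hball he₀ hq, top_sup_eq]
  have hparam : Tendsto (fun i => (e (Λ X (x i)).starProjection, ψ (x i) - ψ y)) atTop
      (𝓝 (e₀, (0 : Euc n))) := by
    refine helim.prodMk_nhds ?_
    have h1 := ((ψ.continuousAt hyψ).tendsto.comp hx).sub_const (ψ y)
    rwa [sub_self] at h1
  have hnhds : ∀ᶠ s in 𝓝 (e₀, (0 : Euc n)),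
      TransverseToFoliation n n f Strata (pinchFamily hR hball s) := by
    let _ := strongTopology n N n N
    exact tendsto_pinchFamily hR hball hs₀ (hO.mem_nhds hmem)
  have hOev := hparam.eventually hnhds
  obtain ⟨i, hi, hsi, hxi, hνi⟩ := (hOev.and ((hparam.eventually
    ((isOpen_pinchParams (r / 7)).mem_nhds hs₀)).and ((hx.eventually
      (ψ.open_source.mem_nhds hyψ)).and (hνlim.eventually_ne hν₀)))).exists
  set s := (e (Λ X (x i)).starProjection, ψ (x i) - ψ y) with hsdef
  have hval : pinchMap y (r / 7) s y = x i := by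
    rw [pinchMap_center, hsdef]
    change ψ.symm (ψ y + (ψ (x i) - ψ y)) = x i
    rw [add_sub_cancel, ψ.left_inv hxi]
  have htr : TransverseToFoliation n n f Strata (pinchFamily hR hball s) := hi
  rw [coe_pinchFamily hR hball hsi, transverseToFoliation_iff] at htr
  have htop := htr X hX y (by rw [hval]; exact hxX i)
  rw [range_mfderiv_sup_eq_top_iff hψ hψ
    ((contMDiff_pinchMap hR hball hsi).mdifferentiable one_ne_zero y) hyψ
    (pinchMap_mem_source hR hball hsi hyψ), fderiv_chart_pinchMap hR hball hsi hyψ] at htop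
  change _ ⊔ Λ X (pinchMap y (r / 7) s y) = ⊤ at htop
  rw [hval] at htop
  -- both summands are orthogonal to the unit vector `s.1`
  have hunit : ⟪s.1, s.1⟫ = 1 := by
    rw [real_inner_self_eq_norm_sq, he _ hνi, one_pow]
  have hall : ∀ w : Euc n, ⟪s.1, w⟫ = 0 := by
    intro w
    have hw : w ∈ (⊤ : Submodule ℝ (Euc n)) := trivial
    rw [← htop] at hw
    obtain ⟨_, ⟨a, rfl⟩, b, hb, rfl⟩ := Submodule.mem_sup.1 hw
    have h1 : ⟪s.1, fderiv ℝ (pinch (ψ y) (r / 7) s) (ψ y) a⟫ = 0 := by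
      rw [fderiv_pinch_center, inner_sub_right, inner_smul_right, hunit, mul_one, sub_self]
    rw [inner_add_right, horth _ b hb, add_zero]
    exact h1
  exact one_ne_zero (hunit.symm.trans (hall s.1))

end Necessity

end ThomRegularity

theorem theorem4p1 {n p : ℕ}
    {N : Type u} [TopologicalSpace N] [ChartedSpace (EuclideanSpace ℝ (Fin n)) N]
    [IsManifold (𝓡 n) 1 N] [T2Space N] [SecondCountableTopology N]
    {P : Type v} [TopologicalSpace P] [ChartedSpace (EuclideanSpace ℝ (Fin p)) P]
    [IsManifold (𝓡 p) 1 P] [T2Space P] [SecondCountableTopology P]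
    (V : Set N) (hV : IsClosed V)
    (Strata : Set (Set N)) (hStrata : ThomRegularity.IsPrestratification n V Strata)
    (f : N → P) (hf : ThomRegularity.IsStratifiedMap n p f Strata) :
    List.TFAE
      [ThomRegularity.IsThomRegular n f Strata,
        ∀ (m : ℕ) (M : Type u) [TopologicalSpace M] [ChartedSpace (EuclideanSpace ℝ (Fin m)) M]
          [IsManifold (𝓡 m) 1 M] [T2Space M] [SecondCountableTopology M],
          IsOpen[ThomRegularity.strongTopology m M n N]
            {g : C^1⟮𝓡 m, M; 𝓡 n, N⟯ | ThomRegularity.TransverseToFoliation m n f Strata g},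
        IsOpen[ThomRegularity.strongTopology n N n N]
          {g : C^1⟮𝓡 n, N; 𝓡 n, N⟯ | ThomRegularity.TransverseToFoliation n n f Strata g}] := by
  tfae_have 1 → 2 := fun h m M _ _ _ _ _ => h.isOpen_transverseToFoliation hV hStrata
  tfae_have 2 → 3 := fun h => h n N
  tfae_have 3 → 1 := ThomRegularity.isThomRegular_of_isOpen hStrata.pairwiseDisjoint
  tfae_finish
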